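/- Let $a,b,c$ be real numbers with $a^2+b^2+c^2=abc$ and $2<a\le b\le c<ab/2$. Put $$T_0=\begin{pmatrix}0&-a/c\\ c/a&0\end{pmatrix},\quad T_1=\begin{pmatrix}a/c&*\\ b/a&-a/c\end{pmatrix},\quad T_2=\begin{pmatrix}a-b/c&*\\ 1&-a+b/c\end{pmatrix}$$ (of determinant one) and let $S^{a}:z\mapsto z+a$, so that $T_2T_1T_0=S^{a}$. All elements are considered as Möbius transformations of the upper half plane $\mathcal H=\{X+iY : Y>0\}$. For $A=\begin{pmatrix}\alpha&\beta\\ \gamma&-\alpha\end{pmatrix}\in \mathrm{SL}(2,\mathbb R)$ with $\gamma\ne0$ let $\mathcal U(A)=\{X+iY\in\mathcal H : |(X-\alpha/\gamma)^2-Y^2|<1/\gamma^2\}$, and let $\mathcal U_-(A)$ and $\mathcal U_+(A)$ be its parts with $X<\alpha/\gamma$ and $X\ge\alpha/\gamma$, respectively. On triples of elements of order two let $$\nu(E,F,G)=(FEF,\,G,\,S^{a}FS^{-a}),\quad \rho(E,F,G)=(FGF,\,F,\,S^{a}ES^{-a}),\quad \lambda(E,F,G)=(EFE,\,E,\,G).$$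 Let $\mathcal T^{\nu}_{\lambda,\rho}$ be the tree whose nodes are the triples obtained from $(T_0,T_1,T_2)$ or from $\nu(T_0,T_1,T_2)$ by finite (possibly empty) compositions of $\lambda$ and $\rho$. The uplift configuration is the union of the regions $\mathcal U_-(G)\cup\mathcal U_+(F)$ over all nodes $(E,F,G)$; the normalized uplift configuration is obtained by replacing, among the regions that make up this union, $\mathcal U_+(T_2)$ by its horizontal translate by $-a$. Let $R$ be the set that consists of the first entries $E$ of all nodes $(E,F,G)$ of $\mathcal T^{\nu}_{\lambda,\rho}$, of $T_1$, and of $S^{-a}T_2S^{a}$. Then $R$ represents the order-two elements that appear in the triples at the nodes of $\mathcal T^{\nu}_{\lambda,\rho}$, up to conjugation by powers of $S^a$: each appearing element is conjugate by a power of $S^a$ to exactly one element of $R$, and each element of $R$ is so conjugate to an appearing one. For each $T\in R$, the set $\mathcal U_+(T)\cup\mathcal U_-(S^{a}TS^{-a})$ meets the line $Y=a/2$ in a non-empty bounded open interval. These intervals, for distinct $T\in R$, are pairwise disjoint, and the normalized uplift configuration meets the line $Y=a/2$ in exactly their union: $$\bigsqcup_{T\in R}\ \bigl(\mathcal U_{+}(T)\cup\mathcal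 U_{-}(S^{a}TS^{-a})\bigr)\cap\{Y=a/2\}.$$ -/

import Mathlib

open scoped MatrixGroups

noncomputable section

namespace Uplift

/-- A Fricke triple, normalised to be the representative of its orbit under the
Teichmueller modular group. -/
structure FrickeTriple where
  a : ℝ
  b : ℝ
  c : ℝ
  fricke : a ^ 2 + b ^ 2 + c ^ 2 = a * b * c
  two_lt : 2 < a
  a_le_b : a ≤ b
  b_le_c : b ≤ c
  c_lt : c < a * b / 2

/-- The matrix with first column `(α, γ)`, trace zero and determinant one. -/
def traceless (α γ : ℝ) (hγ : γ ≠ 0) : SL(2, ℝ) :=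
  ⟨!![α, -(1 + α ^ 2) / γ; γ, -α], by
    rw [Matrix.det_fin_two_of]; field_simp; ring⟩

/-- The translation `z ↦ z + t`. -/
def translation (t : ℝ) : SL(2, ℝ) :=
  ⟨!![1, t; 0, 1], by simp [Matrix.det_fin_two_of]⟩

namespace FrickeTriple

variable (P : FrickeTriple)

theorem a_pos : 0 < P.a := by linarith [P.two_lt]

theorem b_pos : 0 < P.b := lt_of_lt_of_le P.a_pos P.a_le_b

theorem c_pos : 0 < P.c := lt_of_lt_of_le P.b_pos P.b_le_c

def T₀ : SL(2, ℝ) := traceless 0 (P.c / P.a) (div_pos P.c_pos P.a_pos).ne'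

def T₁ : SL(2, ℝ) := traceless (P.a / P.c) (P.b / P.a) (div_pos P.b_pos P.a_pos).ne'

def T₂ : SL(2, ℝ) := traceless (P.a - P.b / P.c) 1 one_ne_zero

end FrickeTriple

/-! Uplift regions -/

/-- The uplift region of `A = (α, β; γ, -α)`. -/
def region (A : SL(2, ℝ)) : Set UpperHalfPlane :=
  {w | |(w.re - A.1 0 0 / A.1 1 0) ^ 2 - w.im ^ 2| < 1 / (A.1 1 0) ^ 2}

/-- The left half of the uplift region. -/
def regionMinus (A : SL(2, ℝ)) : Set UpperHalfPlane :=
  {w | w ∈ region A ∧ w.re < A.1 0 0 / A.1 1 0}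

/-- The right half of the uplift region. -/
def regionPlus (A : SL(2, ℝ)) : Set UpperHalfPlane :=
  {w | w ∈ region A ∧ A.1 0 0 / A.1 1 0 ≤ w.re}

/-- The horizontal (Euclidean) line `Y = h` in the upper half plane. -/
def line (h : ℝ) : Set UpperHalfPlane := {w | w.im = h}

/-- `S^t A S^{-t}`. -/
def shift (t : ℝ) (A : SL(2, ℝ)) : SL(2, ℝ) := translation t * A * (translation t)⁻¹

/-- The trace on the line `Y = a/2` of `U₊(A) ∪ U₋(S^a A S^{-a})`. -/
def excision (a : ℝ) (A : SL(2, ℝ)) : Set UpperHalfPlane :=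
  (regionPlus A ∪ regionMinus (shift a A)) ∩ line (a / 2)

/-! Triples and their moves -/

@[ext]
structure Triple where
  E : SL(2, ℝ)
  F : SL(2, ℝ)
  G : SL(2, ℝ)

namespace Triple

/-! The entries have order two as Moebius transformations, i.e. their square is `-1` in
`SL(2, ℝ)`.  So `F E F⁻¹` represents the transformation `F E F`; this choice of the sign makes all
entries matrices with positive lower left entry, one for each transformation. -/

def nu (a : ℝ) (t : Triple) : Triple := ⟨t.F * t.E * t.F⁻¹, t.G, shift a t.F⟩

def rho (a : ℝ) (t : Triple) : Triple := ⟨t.F * t.G * t.F⁻¹, t.F, shift a t.E⟩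

def lam (t : Triple) : Triple := ⟨t.E * t.F * t.E⁻¹, t.E, t.G⟩

/-- The bicorn region of a triple. -/
def bicorn (t : Triple) : Set UpperHalfPlane := regionMinus t.G ∪ regionPlus t.F

end Triple

/-- The nodes of the tree of all finite compositions of `λ` and `ρ` applied to `t`. -/
inductive Tree (a : ℝ) (t : Triple) : Triple → Prop
  | root : Tree a t t
  | lam (s : Triple) : Tree a t s → Tree a t s.lam
  | rho (s : Triple) : Tree a t s → Tree a t (s.rho a)

namespace FrickeTriple

variable (P : FrickeTriple)

/-- The initial triple `(T₀, T₁, T₂)`. -/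
def base : Triple := ⟨P.T₀, P.T₁, P.T₂⟩

/-- The nodes of the full tree: the `λ, ρ`-tree of `(T₀, T₁, T₂)` joined to that of
`ν (T₀, T₁, T₂)`. -/
def nodes : Set Triple :=
  {t | Tree P.a P.base t ∨ Tree P.a (P.base.nu P.a) t}

/-- The uplift configuration: the union of the bicorn regions of all nodes. -/
def configuration : Set UpperHalfPlane := ⋃ t ∈ P.nodes, t.bicorn

/-- The normalized uplift configuration: among the regions `U₋(G)`, `U₊(F)` that make up the
uplift configuration, `U₊(T₂)` is replaced by its horizontal translate by `-a`. -/
def normalizedConfiguration : Set UpperHalfPlane :=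
  (⋃ t ∈ P.nodes, regionMinus t.G) ∪
    (⋃ t ∈ {t ∈ P.nodes | t.F ≠ P.T₂}, regionPlus t.F) ∪
      (fun w : UpperHalfPlane => (-P.a) +ᵥ w) '' regionPlus P.T₂

/-- The elements that appear in the triple of some node. -/
def appearing : Set SL(2, ℝ) :=
  {T | ∃ t ∈ P.nodes, T = t.E ∨ T = t.F ∨ T = t.G}

/-- The appearing elements, one for each class modulo conjugation by powers of `S^a`: the
`E`-entries of all nodes, the element `T₁`, and (because of the normalization) the translate
`S^{-a} T₂ S^a` of `T₂`. -/
def representatives : Set SL(2, ℝ) :=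
  {T | ∃ t ∈ P.nodes, T = t.E} ∪ {P.T₁, shift (-P.a) P.T₂}

end FrickeTriple

end Uplift

end

namespace Uplift

/-! On the line `Y = a/2` the half turn with centre `p` and lower left entry `e` cuts out the
interval from `p + x` to `p + a - x`, where `x ^ 2 = a ^ 2 / 4 - 1 / e ^ 2` (`excision_eq`). In
every node the lower left entries solve `e ^ 2 + f ^ 2 + g ^ 2 = a * e * f * g` and determine the
distances between the centres; the moves preserve this (`IsMarkov`). The equation yields
`radius_add_radius_lt`, so the interval of `E` lies strictly in the gap between those of `S^{-a} G
S^a` and `F`.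

The moves `λ` and `ρ` pass to the parts of this gap left and right of `E`. Each tree thus subdivides
the gap of its root, as Farey fractions do, and distinct nodes have disjoint intervals
(`Tree.eq_or_separated`). The two root gaps, separated by the interval of `T₁`, lie between those of
`S^{-a} T₂ S^a` and `T₂`, one period apart. Hence representatives are disjoint and inequivalent
under `S^a`.

For the union, `E` becomes the `F` of its `λ`-child and `S^a E S^{-a}` the `G` of its `ρ`-child, so
both halves of each excised region occur (`normalizedConfiguration_eq`). -/

/-! ### Half turns and translations -/

/-- The half turn with centre `p` and lower left entry `e`. -/
noncomputable def halfTurn (p e : ℝ) (he : 0 < e) : SL(2, ℝ) := traceless (e * p) e he.ne'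

theorem coe_halfTurn (p e : ℝ) (he : 0 < e) :
    (halfTurn p e he : Matrix (Fin 2) (Fin 2) ℝ) =
      !![e * p, -(1 + (e * p) ^ 2) / e; e, -(e * p)] := rfl

theorem coe_translation (t : ℝ) :
    (translation t : Matrix (Fin 2) (Fin 2) ℝ) = !![1, t; 0, 1] := rfl

theorem halfTurn_conj {p e q f g f' : ℝ} (he : 0 < e) (hf : 0 < f) (hf' : 0 < f')
    (h : q - p = g / (e * f)) (hm : f * f' = e ^ 2 + g ^ 2) :
    halfTurn p e he * halfTurn q f hf * (halfTurn p e he)⁻¹ =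
      halfTurn (p - g / (e * f')) f' hf' := by
  obtain rfl : q = p + g / (e * f) := by linarith
  obtain rfl : f' = (e ^ 2 + g ^ 2) / f := by field_simp; linarith
  have hs : e ^ 2 + g ^ 2 ≠ 0 := by positivity
  rw [mul_inv_eq_iff_eq_mul]
  apply Subtype.ext
  rw [Matrix.SpecialLinearGroup.coe_mul, Matrix.SpecialLinearGroup.coe_mul]
  simp only [coe_halfTurn]
  ext i j
  fin_cases i <;> fin_cases j <;> simp [Matrix.mul_apply, Fin.sum_univ_two] <;>
    field_simp <;> ring

theorem shift_halfTurn (t p e : ℝ) (he : 0 < e) :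
    shift t (halfTurn p e he) = halfTurn (p + t) e he := by
  rw [shift, mul_inv_eq_iff_eq_mul]
  apply Subtype.ext
  rw [Matrix.SpecialLinearGroup.coe_mul, Matrix.SpecialLinearGroup.coe_mul]
  simp only [coe_halfTurn, coe_translation]
  ext i j
  fin_cases i <;> fin_cases j <;> simp [Matrix.mul_apply, Fin.sum_univ_two] <;>
    field_simp <;> ring

theorem translation_mul (s t : ℝ) : translation s * translation t = translation (s + t) := by
  apply Subtype.ext
  rw [Matrix.SpecialLinearGroup.coe_mul]
  simp [coe_translation, add_comm]

theorem translation_zero : translation 0 = 1 := by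
  ext i j
  fin_cases i <;> fin_cases j <;> simp [translation]

theorem shift_shift (s t : ℝ) (A : SL(2, ℝ)) : shift s (shift t A) = shift (s + t) A := by
  simp only [shift, ← translation_mul, mul_inv_rev, mul_assoc]

theorem shift_zero (A : SL(2, ℝ)) : shift 0 A = A := by
  simp [shift, translation_zero]

theorem shift_neg_shift (t : ℝ) (A : SL(2, ℝ)) : shift (-t) (shift t A) = A := by
  rw [shift_shift, neg_add_cancel, shift_zero]

theorem shift_shift_neg (t : ℝ) (A : SL(2, ℝ)) : shift t (shift (-t) A) = A := by
  rw [shift_shift, add_neg_cancel, shift_zero]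

/-! ### Traces on the line `Y = a/2` -/

/-- The left endpoint of the trace of the excised region of `A` on the line `Y = a/2`. -/
noncomputable def left (a : ℝ) (A : SL(2, ℝ)) : ℝ :=
  A.1 0 0 / A.1 1 0 + √(a ^ 2 / 4 - 1 / (A.1 1 0) ^ 2)

/-- The right endpoint of the trace of the excised region of `A` on the line `Y = a/2`. -/
noncomputable def right (a : ℝ) (A : SL(2, ℝ)) : ℝ :=
  A.1 0 0 / A.1 1 0 + a - √(a ^ 2 / 4 - 1 / (A.1 1 0) ^ 2)

theorem halfTurn_center (p e : ℝ) (he : 0 < e) :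
    (halfTurn p e he).1 0 0 / (halfTurn p e he).1 1 0 = p := by
  simp [halfTurn, traceless, he.ne']

theorem halfTurn_height (p e : ℝ) (he : 0 < e) : (halfTurn p e he).1 1 0 = e := by
  simp [halfTurn, traceless]

theorem left_halfTurn (a p e : ℝ) (he : 0 < e) :
    left a (halfTurn p e he) = p + √(a ^ 2 / 4 - 1 / e ^ 2) := by
  rw [left, halfTurn_center, halfTurn_height]

theorem right_halfTurn (a p e : ℝ) (he : 0 < e) :
    right a (halfTurn p e he) = p + a - √(a ^ 2 / 4 - 1 / e ^ 2) := by
  rw [right, halfTurn_center, halfTurn_height]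

/-- `A` is a half turn whose lower left entry is large enough for `a`. -/
def IsWide (a : ℝ) (A : SL(2, ℝ)) : Prop :=
  ∃ p e, ∃ he : 0 < e, A = halfTurn p e he ∧ 1 / e ^ 2 ≤ a ^ 2 / 4

theorem IsWide.shift {a : ℝ} {A : SL(2, ℝ)} (h : IsWide a A) (t : ℝ) :
    IsWide a (shift t A) := by
  obtain ⟨p, e, he, rfl, hw⟩ := h
  exact ⟨p + t, e, he, shift_halfTurn t p e he, hw⟩

theorem IsWide.left_shift {a : ℝ} {A : SL(2, ℝ)} (h : IsWide a A) (t : ℝ) :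
    left a (Uplift.shift t A) = left a A + t := by
  obtain ⟨p, e, he, rfl, -⟩ := h
  rw [shift_halfTurn, left_halfTurn, left_halfTurn]
  ring

theorem IsWide.left_lt_right {a : ℝ} (ha : 0 < a) {A : SL(2, ℝ)} (h : IsWide a A) :
    left a A < right a A := by
  obtain ⟨p, e, he, rfl, hw⟩ := h
  rw [left_halfTurn, right_halfTurn]
  have : √(a ^ 2 / 4 - 1 / e ^ 2) < a / 2 := by
    rw [Real.sqrt_lt' (by positivity)]
    have : 0 < 1 / e ^ 2 := by positivity
    nlinarith
  linarith

/-- The reflection `x ↦ a - x` exchanges the inner ends of the two halves, which meet at `a / 2`.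
Neither half overshoots, since `(a - s) ^ 2 - (a ^ 2 / 4 + k) = 2 * (s - a / 2) ^ 2`. -/
theorem excision_coordinate {a s k x : ℝ} (_ : 0 < k) (hs : 0 ≤ s) (hsk : s ^ 2 = a ^ 2 / 4 - k)
    (hsa : s < a / 2) :
    (|x ^ 2 - (a / 2) ^ 2| < k ∧ 0 ≤ x ∨ |(x - a) ^ 2 - (a / 2) ^ 2| < k ∧ x < a) ↔
      s < x ∧ x < a - s := by
  simp only [abs_lt]
  constructor
  · rintro (⟨⟨h1, h2⟩, h3⟩ | ⟨⟨h1, h2⟩, h3⟩)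
    · constructor
      · nlinarith
      · by_contra! h
        nlinarith [sq_nonneg (s - a / 2)]
    · constructor
      · by_contra! h
        nlinarith [sq_nonneg (s - a / 2)]
      · nlinarith
  · rintro ⟨h1, h2⟩
    rcases le_total x (a / 2) with h | h
    · left
      refine ⟨⟨?_, ?_⟩, ?_⟩ <;> nlinarith
    · right
      refine ⟨⟨?_, ?_⟩, ?_⟩ <;> nlinarith

theorem excision_eq {a : ℝ} (ha : 0 < a) {A : SL(2, ℝ)} (h : IsWide a A) :
    excision a A =
      {w : UpperHalfPlane | w.im = a / 2 ∧ w.re ∈ Set.Ioo (left a A) (right a A)} := by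
  have hlr := h.left_lt_right ha
  obtain ⟨p, e, he, rfl, hw⟩ := h
  rw [left_halfTurn, right_halfTurn] at *
  ext w
  simp only [excision, regionPlus, regionMinus, region, line, shift_halfTurn, halfTurn_center,
    Set.mem_inter_iff, Set.mem_union, Set.mem_ofPred_eq, Set.mem_Ioo]
  simp only [halfTurn_height]
  rw [and_comm]
  refine and_congr_right fun him => ?_
  have key := excision_coordinate (a := a) (x := w.re - p) (k := 1 / e ^ 2) (by positivity)
    (Real.sqrt_nonneg _) (Real.sq_sqrt (sub_nonneg.2 hw)) (by linarith)
  rw [him, show w.re - (p + a) = w.re - p - a by ring]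
  rw [sub_nonneg, sub_lt_iff_lt_add'] at key
  rw [key, lt_sub_iff_add_lt', sub_lt_iff_lt_add', add_sub_assoc]

theorem disjoint_excision {a : ℝ} (ha : 0 < a) {A B : SL(2, ℝ)} (hA : IsWide a A)
    (hB : IsWide a B) (h : right a A < left a B) : Disjoint (excision a A) (excision a B) := by
  rw [excision_eq ha hA, excision_eq ha hB, Set.disjoint_left]
  rintro w ⟨-, -, h1⟩ ⟨-, h2, -⟩
  linarith

/-! ### Markov triples and their moves -/

/-- The triple consists of half turns whose lower left entries solve the Markov equation
with parameter `a`, the differences of the centres being the corresponding quotients. -/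
def IsMarkov (a : ℝ) (t : Triple) : Prop :=
  ∃ p e q f s g, ∃ (he : 0 < e) (hf : 0 < f) (hg : 0 < g),
    t = ⟨halfTurn p e he, halfTurn q f hf, halfTurn s g hg⟩ ∧
    q - p = g / (e * f) ∧ s - q = e / (f * g) ∧ e ^ 2 + f ^ 2 + g ^ 2 = a * e * f * g

namespace IsMarkov

variable {a : ℝ} {t : Triple}

/-- As a quadratic in `f`, the Markov equation has root product `e ^ 2 + g ^ 2` and root sum `a * e
* g`; the conjugation exchanges its two roots. The product form shows that the new entry is
positive, the sum form that it solves the equation. -/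
theorem lam (h : IsMarkov a t) : IsMarkov a t.lam := by
  obtain ⟨p, e, q, f, s, g, he, hf, hg, rfl, hqp, hsq, hm⟩ := h
  have hf' : 0 < (e ^ 2 + g ^ 2) / f := by positivity
  have hmul : f * ((e ^ 2 + g ^ 2) / f) = e ^ 2 + g ^ 2 := by field_simp
  have hconj := halfTurn_conj he hf hf' hqp hmul
  generalize (e ^ 2 + g ^ 2) / f = f' at *
  refine ⟨p - g / (e * f'), f', p, e, s, g, hf', he, hg, ?_, ?_, ?_, ?_⟩
  · simp only [Triple.lam, hconj]
  · rw [mul_comm f' e]; ring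
  · have : s - p = g / (e * f) + e / (f * g) := by linarith
    rw [this]
    field_simp
    linarith
  · have : f * (f' - (a * e * g - f)) = 0 := by linarith
    have := (mul_eq_zero.1 this).resolve_left hf.ne'
    obtain rfl : f' = a * e * g - f := by linarith
    linarith

theorem rho (h : IsMarkov a t) : IsMarkov a (t.rho a) := by
  obtain ⟨p, e, q, f, s, g, he, hf, hg, rfl, hqp, hsq, hm⟩ := h
  have hg' : 0 < (f ^ 2 + e ^ 2) / g := by positivity
  have hmul : g * ((f ^ 2 + e ^ 2) / g) = f ^ 2 + e ^ 2 := by field_simp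
  have hconj := halfTurn_conj hf hg hg' hsq hmul
  generalize (f ^ 2 + e ^ 2) / g = g' at *
  have : g * (g' - (a * e * f - g)) = 0 := by linarith
  have := (mul_eq_zero.1 this).resolve_left hg.ne'
  refine ⟨q - e / (f * g'), g', q, f, p + a, e, hg', hf, he, ?_, ?_, ?_, ?_⟩
  · simp only [Triple.rho, hconj, shift_halfTurn]
  · rw [mul_comm g' f]; ring
  · have : p + a - q = a - g / (e * f) := by linarith
    rw [this]
    field_simp
    linarith
  · obtain rfl : g' = a * e * f - g := by linarith
    linarith

theorem nu (h : IsMarkov a t) : IsMarkov a (t.nu a) := by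
  obtain ⟨p, e, q, f, s, g, he, hf, hg, rfl, hqp, hsq, hm⟩ := h
  -- Here the conjugated element has its centre to the left of the conjugating one, so
  -- `halfTurn_conj` is applied with `-g`.
  have he' : 0 < (f ^ 2 + (-g) ^ 2) / e := by positivity
  have hmul : e * ((f ^ 2 + (-g) ^ 2) / e) = f ^ 2 + (-g) ^ 2 := by field_simp
  have hpq : p - q = -g / (f * e) := by rw [mul_comm f e, neg_div]; linarith
  have hconj := halfTurn_conj hf he he' hpq hmul
  generalize (f ^ 2 + (-g) ^ 2) / e = e' at *
  have : e * (e' - (a * f * g - e)) = 0 := by linarith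
  have := (mul_eq_zero.1 this).resolve_left he.ne'
  refine ⟨q - -g / (f * e'), e', s, g, q + a, f, he', hg, hf, ?_, ?_, ?_, ?_⟩
  · simp only [Triple.nu, hconj, shift_halfTurn]
  · have : s - (q - -g / (f * e')) = e / (f * g) - g / (f * e') := by
      rw [neg_div]; linarith
    rw [this]
    field_simp
    linarith
  · have : q + a - s = a - e / (f * g) := by linarith
    rw [this]
    field_simp
    linarith
  · obtain rfl : e' = a * f * g - e := by linarith
    linarith

end IsMarkov

/-! ### Separation of neighbouring intervals -/

theorem inv_sq_add_inv_sq_le {a e f g : ℝ} (he : 0 < e) (hg : 0 < g)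
    (hm : e ^ 2 + f ^ 2 + g ^ 2 = a * e * f * g) : 1 / e ^ 2 + 1 / g ^ 2 ≤ a ^ 2 / 4 := by
  have h : a ^ 2 / 4 - (1 / e ^ 2 + 1 / g ^ 2) = ((f - a * e * g / 2) / (e * g)) ^ 2 := by
    field_simp
    linarith
  nlinarith [sq_nonneg ((f - a * e * g / 2) / (e * g))]

/-- The gap between two neighbouring centres exceeds the sum of the two radii. -/
theorem radius_add_radius_lt {a e f g : ℝ} (ha : 0 < a) (he : 0 < e) (hg : 0 < g)
    (hm : e ^ 2 + f ^ 2 + g ^ 2 = a * e * f * g) :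
    a - √(a ^ 2 / 4 - 1 / e ^ 2) - √(a ^ 2 / 4 - 1 / g ^ 2) < f / (e * g) := by
  have hle := inv_sq_add_inv_sq_le he hg hm
  have hk : 0 < 1 / e ^ 2 := by positivity
  have hl : 0 < 1 / g ^ 2 := by positivity
  -- The Markov equation divided by `(e * g) ^ 2`, a quadratic in the distance `u` of the centres.
  have hu : (f / (e * g)) ^ 2 - a * (f / (e * g)) + 1 / e ^ 2 + 1 / g ^ 2 = 0 := by
    field_simp
    linarith
  have hx2 := Real.sq_sqrt (show 0 ≤ a ^ 2 / 4 - 1 / e ^ 2 by linarith)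
  have hy2 := Real.sq_sqrt (show 0 ≤ a ^ 2 / 4 - 1 / g ^ 2 by linarith)
  have hx := Real.sqrt_nonneg (a ^ 2 / 4 - 1 / e ^ 2)
  have hy := Real.sqrt_nonneg (a ^ 2 / 4 - 1 / g ^ 2)
  generalize √(a ^ 2 / 4 - 1 / e ^ 2) = x at *
  generalize √(a ^ 2 / 4 - 1 / g ^ 2) = y at *
  generalize f / (e * g) = u at *
  have hx' : x < a / 2 := by nlinarith
  have hy' : y < a / 2 := by nlinarith
  have hxy : a / 2 ≤ x + y := by nlinarith [mul_nonneg hx hy]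
  by_contra! h
  -- The quadratic decreases left of `a / 2`, and `a - x - y ≤ a / 2`. Its value at `a - x - y` is
  -- `2 * (a / 2 - x) * (a / 2 - y) > 0`, so its root `u` cannot lie at or below that point.
  have h1 : 0 ≤ (a - x - y - u) * (x + y - (a - x - y) + (a - x - y - u)) :=
    mul_nonneg (by linarith) (by linarith)
  have h2 : 0 < (a / 2 - x) * (a / 2 - y) := mul_pos (by linarith) (by linarith)
  nlinarith

namespace IsMarkov

variable {a : ℝ} {t : Triple}

theorem isWide_E (h : IsMarkov a t) : IsWide a t.E := by
  obtain ⟨p, e, q, f, s, g, he, hf, hg, rfl, -, -, hm⟩ := h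
  have := inv_sq_add_inv_sq_le he hg hm
  have : 0 < 1 / g ^ 2 := by positivity
  exact ⟨p, e, he, rfl, by linarith⟩

theorem isWide_F (h : IsMarkov a t) : IsWide a t.F := by
  obtain ⟨p, e, q, f, s, g, he, hf, hg, rfl, -, -, hm⟩ := h
  have := inv_sq_add_inv_sq_le (f := g) hf he (by linarith)
  have : 0 < 1 / e ^ 2 := by positivity
  exact ⟨q, f, hf, rfl, by linarith⟩

theorem isWide_G (h : IsMarkov a t) : IsWide a t.G := by
  obtain ⟨p, e, q, f, s, g, he, hf, hg, rfl, -, -, hm⟩ := h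
  have := inv_sq_add_inv_sq_le he hg hm
  have : 0 < 1 / e ^ 2 := by positivity
  exact ⟨s, g, hg, rfl, by linarith⟩

theorem right_lt_left_E (ha : 0 < a) (h : IsMarkov a t) :
    right a (shift (-a) t.G) < left a t.E := by
  obtain ⟨p, e, q, f, s, g, he, hf, hg, rfl, hqp, hsq, hm⟩ := h
  have := radius_add_radius_lt ha he hg hm
  -- By the Markov equation the three cyclic distances add up to the period `a`.
  have hu : p - (s - a) = f / (e * g) := by
    have : p - (s - a) = a - g / (e * f) - e / (f * g) := by linarith
    rw [this]
    field_simp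
    linarith
  rw [shift_halfTurn, left_halfTurn, right_halfTurn]
  linarith

theorem right_E_lt_left_F (ha : 0 < a) (h : IsMarkov a t) : right a t.E < left a t.F := by
  obtain ⟨p, e, q, f, s, g, he, hf, hg, rfl, hqp, hsq, hm⟩ := h
  have := radius_add_radius_lt (f := g) ha he hf (by linarith)
  rw [left_halfTurn, right_halfTurn]
  linarith

end IsMarkov


/-! ### Subdivision of the gaps along a tree -/

namespace Tree

variable {a : ℝ} {t s s' : Triple}

theorem isMarkov (hs : Tree a t s) (ht : IsMarkov a t) : IsMarkov a s := by
  induction hs with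
  | root => exact ht
  | lam s _ ih => exact ih.lam
  | rho s _ ih => exact ih.rho

theorem eq_or_lam_or_rho (hs : Tree a t s) :
    s = t ∨ Tree a t.lam s ∨ Tree a (t.rho a) s := by
  induction hs with
  | root => exact .inl rfl
  | lam s _ ih =>
    rcases ih with rfl | h | h
    · exact .inr (.inl .root)
    · exact .inr (.inl (.lam _ h))
    · exact .inr (.inr (.lam _ h))
  | rho s _ ih =>
    rcases ih with rfl | h | h
    · exact .inr (.inr .root)
    · exact .inr (.inl (.rho _ h))
    · exact .inr (.inr (.rho _ h))

/-- The interval of `s.E` lies in the gap spanned by the root. -/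
theorem between (ha : 0 < a) (hs : Tree a t s) (ht : IsMarkov a t) :
    right a (shift (-a) t.G) < left a s.E ∧ right a s.E < left a t.F := by
  -- Gaps shrink weakly along the tree; strictness comes from the neighbour inequalities at `s`.
  suffices right a (shift (-a) t.G) ≤ right a (shift (-a) s.G) ∧ left a s.F ≤ left a t.F from
    ⟨this.1.trans_lt ((hs.isMarkov ht).right_lt_left_E ha),
      ((hs.isMarkov ht).right_E_lt_left_F ha).trans_le this.2⟩
  induction hs with
  | root => exact ⟨le_rfl, le_rfl⟩
  | lam s hs ih =>
    have hm := hs.isMarkov ht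
    have := hm.isWide_E.left_lt_right ha
    have := hm.right_E_lt_left_F ha
    exact ⟨ih.1, by change left a s.E ≤ _; linarith [ih.2]⟩
  | rho s hs ih =>
    have hm := hs.isMarkov ht
    have := hm.isWide_E.left_lt_right ha
    have := hm.right_lt_left_E ha
    refine ⟨?_, ih.2⟩
    change _ ≤ right a (shift (-a) (shift a s.E))
    rw [shift_neg_shift]
    linarith [ih.1]

/-- A node lies below `s`, or its interval lies outside the gap spanned by `s`. -/
theorem below_or_outside (ha : 0 < a) (ht : IsMarkov a t) (hs : Tree a t s) (hs' : Tree a t s') :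
    Tree a s s' ∨ right a s'.E ≤ right a (shift (-a) s.G) ∨ left a s.F ≤ left a s'.E := by
  induction hs with
  | root => exact .inl hs'
  | lam s hs ih =>
    have hm := hs.isMarkov ht
    have := hm.isWide_E.left_lt_right ha
    have := hm.right_E_lt_left_F ha
    change _ ∨ _ ≤ right a (shift (-a) s.G) ∨ left a s.E ≤ _
    rcases ih with h | h | h
    · rcases h.eq_or_lam_or_rho with rfl | h | h
      · exact .inr (.inr le_rfl)
      · exact .inl h
      · have := (h.between ha hm.rho).1
        simp only [Triple.rho, shift_neg_shift] at this
        exact .inr (.inr (by linarith))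
    · exact .inr (.inl h)
    · exact .inr (.inr (by linarith))
  | rho s hs ih =>
    have hm := hs.isMarkov ht
    have := hm.isWide_E.left_lt_right ha
    have := hm.right_lt_left_E ha
    change _ ∨ _ ≤ right a (shift (-a) (shift a s.E)) ∨ left a s.F ≤ _
    rw [shift_neg_shift]
    rcases ih with h | h | h
    · rcases h.eq_or_lam_or_rho with rfl | h | h
      · exact .inr (.inl le_rfl)
      · have : right a s'.E < left a s.E := (h.between ha hm.lam).2
        exact .inr (.inl (by linarith))
      · exact .inl h
    · exact .inr (.inl (by linarith))
    · exact .inr (.inr h)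

theorem eq_or_separated (ha : 0 < a) (ht : IsMarkov a t) (hs : Tree a t s) (hs' : Tree a t s') :
    s = s' ∨ right a s.E < left a s'.E ∨ right a s'.E < left a s.E := by
  have hm := hs.isMarkov ht
  rcases below_or_outside ha ht hs hs' with h | h | h
  · rcases h.eq_or_lam_or_rho with rfl | h | h
    · exact .inl rfl
    · exact .inr (.inr (h.between ha hm.lam).2)
    · have := (h.between ha hm.rho).1
      simp only [Triple.rho, shift_neg_shift] at this
      exact .inr (.inl this)
  · exact .inr (.inr (h.trans_lt (hm.right_lt_left_E ha)))
  · exact .inr (.inl ((hm.right_E_lt_left_F ha).trans_le h))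

end Tree

theorem vadd_image_regionPlus (t : ℝ) {a : ℝ} {A : SL(2, ℝ)} (h : IsWide a A) :
    (fun w : UpperHalfPlane => t +ᵥ w) '' regionPlus A = regionPlus (shift t A) := by
  obtain ⟨p, e, he, rfl, -⟩ := h
  ext w
  simp only [Set.mem_image, regionPlus, region, shift_halfTurn, halfTurn_center,
    Set.mem_ofPred_eq]
  simp only [halfTurn_height]
  constructor
  · rintro ⟨w, h, rfl⟩
    rw [UpperHalfPlane.vadd_re, UpperHalfPlane.vadd_im, show t + w.re - (p + t) = w.re - p by ring]
    exact ⟨h.1, by linarith [h.2]⟩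
  · rintro h
    refine ⟨-t +ᵥ w, ?_, by simp⟩
    rw [UpperHalfPlane.vadd_re, UpperHalfPlane.vadd_im, show -t + w.re - p = w.re - (p + t) by ring]
    exact ⟨h.1, by linarith [h.2]⟩

/-! ### The two trees of a Fricke triple -/

namespace FrickeTriple

variable (P : FrickeTriple)

theorem isMarkov_base : IsMarkov P.a P.base := by
  have ha := P.a_pos
  have hb := P.b_pos
  have hc := P.c_pos
  have h := P.fricke
  -- The Fricke equation divided by `a ^ 2` is the Markov equation for `(c / a, b / a, 1)`.
  refine ⟨0, P.c / P.a, P.a ^ 2 / (P.b * P.c), P.b / P.a, P.a - P.b / P.c, 1, div_pos hc ha,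
    div_pos hb ha, one_pos, ?_, ?_, ?_, ?_⟩
  · have h1 : P.b / P.a * (P.a ^ 2 / (P.b * P.c)) = P.a / P.c := by field_simp
    simp only [base, T₀, T₁, T₂, halfTurn, mul_zero, one_mul, h1]
  · field_simp
    ring
  · field_simp
    linarith
  · field_simp
    linarith

theorem isMarkov_of_mem_nodes {t : Triple} (ht : t ∈ P.nodes) : IsMarkov P.a t := by
  rcases ht with h | h
  · exact h.isMarkov P.isMarkov_base
  · exact h.isMarkov P.isMarkov_base.nu

theorem lam_mem_nodes {t : Triple} (ht : t ∈ P.nodes) : t.lam ∈ P.nodes :=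
  ht.imp (.lam t) (.lam t)

theorem rho_mem_nodes {t : Triple} (ht : t ∈ P.nodes) : t.rho P.a ∈ P.nodes :=
  ht.imp (.rho t) (.rho t)

theorem base_mem_nodes : P.base ∈ P.nodes := .inl .root

theorem nu_base_mem_nodes : P.base.nu P.a ∈ P.nodes := .inr .root

theorem E_mem_representatives {t : Triple} (ht : t ∈ P.nodes) : t.E ∈ P.representatives :=
  .inl ⟨t, ht, rfl⟩

theorem T₁_mem_representatives : P.T₁ ∈ P.representatives := .inr (.inl rfl)

theorem shift_T₂_mem_representatives : shift (-P.a) P.T₂ ∈ P.representatives :=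
  .inr (.inr rfl)

/-- Below a root, each `F` or `G` is inherited or comes from the `E` of the parent. The exception
`T₂` is the `F` of the second root, and `ρ` passes it on. -/
theorem F_G_mem_representatives {t : Triple} (ht : t ∈ P.nodes) :
    (t.F ∈ P.representatives ∨ t.F = P.T₂) ∧ shift (-P.a) t.G ∈ P.representatives := by
  rcases ht with h | h
  · induction h with
    | root => exact ⟨.inl P.T₁_mem_representatives, P.shift_T₂_mem_representatives⟩
    | lam s hs ih => exact ⟨.inl (P.E_mem_representatives (.inl hs)), ih.2⟩
    | rho s hs ih =>
      refine ⟨ih.1, ?_⟩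
      change shift (-P.a) (shift P.a s.E) ∈ _
      rw [shift_neg_shift]
      exact P.E_mem_representatives (.inl hs)
  · induction h with
    | root =>
      refine ⟨.inr rfl, ?_⟩
      change shift (-P.a) (shift P.a P.T₁) ∈ _
      rw [shift_neg_shift]
      exact P.T₁_mem_representatives
    | lam s hs ih => exact ⟨.inl (P.E_mem_representatives (.inr hs)), ih.2⟩
    | rho s hs ih =>
      refine ⟨ih.1, ?_⟩
      change shift (-P.a) (shift P.a s.E) ∈ _
      rw [shift_neg_shift]
      exact P.E_mem_representatives (.inr hs)

theorem isWide_T₁ : IsWide P.a P.T₁ := P.isMarkov_base.isWide_F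

theorem isWide_T₂ : IsWide P.a P.T₂ := P.isMarkov_base.isWide_G

theorem isWide_of_mem_representatives {T : SL(2, ℝ)} (hT : T ∈ P.representatives) :
    IsWide P.a T := by
  rcases hT with ⟨t, ht, rfl⟩ | rfl | rfl
  · exact (P.isMarkov_of_mem_nodes ht).isWide_E
  · exact P.isWide_T₁
  · exact P.isWide_T₂.shift _

/-- The intervals of the first tree lie between those of `S^{-a} T₂ S^a` and `T₁`. -/
theorem between_of_tree_base {s : Triple} (hs : Tree P.a P.base s) :
    right P.a (shift (-P.a) P.T₂) < left P.a s.E ∧ right P.a s.E < left P.a P.T₁ := by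
  have h := hs.between P.a_pos P.isMarkov_base
  simp only [base] at h
  exact h

/-- The intervals of the second tree lie between those of `T₁` and `T₂`. -/
theorem between_of_tree_nu {s : Triple} (hs : Tree P.a (P.base.nu P.a) s) :
    right P.a P.T₁ < left P.a s.E ∧ right P.a s.E < left P.a P.T₂ := by
  have h := hs.between P.a_pos P.isMarkov_base.nu
  simp only [Triple.nu, shift_neg_shift] at h
  exact h

theorem right_shift_T₂_lt_left_T₁ : right P.a (shift (-P.a) P.T₂) < left P.a P.T₁ := by
  have h := P.between_of_tree_base .root
  have := P.isMarkov_base.isWide_E.left_lt_right P.a_pos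
  linarith

theorem right_T₁_lt_left_T₂ : right P.a P.T₁ < left P.a P.T₂ := by
  have h := P.between_of_tree_nu .root
  have := P.isMarkov_base.nu.isWide_E.left_lt_right P.a_pos
  linarith

theorem eq_or_separated {T T' : SL(2, ℝ)} (hT : T ∈ P.representatives)
    (hT' : T' ∈ P.representatives) :
    T = T' ∨ right P.a T < left P.a T' ∨ right P.a T' < left P.a T := by
  have ha := P.a_pos
  have h1 := P.isWide_T₁.left_lt_right ha
  have h12 := P.right_shift_T₂_lt_left_T₁
  have node (t : Triple) (ht : t ∈ P.nodes) :
      right P.a (shift (-P.a) P.T₂) < left P.a t.E ∧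
        (right P.a P.T₁ < left P.a t.E ∨ right P.a t.E < left P.a P.T₁) := by
    rcases ht with h | h
    · have := P.between_of_tree_base h
      exact ⟨this.1, .inr this.2⟩
    · have := P.between_of_tree_nu h
      exact ⟨by linarith, .inl this.1⟩
  rcases hT with ⟨t, ht, rfl⟩ | rfl | rfl <;> rcases hT' with ⟨t', ht', rfl⟩ | rfl | rfl
  · rcases ht with h | h <;> rcases ht' with h' | h'
    · exact (h.eq_or_separated ha P.isMarkov_base h').imp_left (congrArg Triple.E)
    · have := P.between_of_tree_base h
      have := P.between_of_tree_nu h'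
      exact .inr (.inl (by linarith))
    · have := P.between_of_tree_nu h
      have := P.between_of_tree_base h'
      exact .inr (.inr (by linarith))
    · exact (h.eq_or_separated ha P.isMarkov_base.nu h').imp_left (congrArg Triple.E)
  · exact .inr (node t ht).2.symm
  · exact .inr (.inr (node t ht).1)
  · exact .inr (node t' ht').2
  · exact .inl rfl
  · exact .inr (.inr h12)
  · exact .inr (.inl (node t' ht').1)
  · exact .inr (.inl h12)
  · exact .inl rfl

/-- The representatives start in one period, the half open interval from `S^{-a} T₂ S^a` to
`T₂`. -/
theorem left_mem_Ico {T : SL(2, ℝ)} (hT : T ∈ P.representatives) :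
    left P.a T ∈ Set.Ico (left P.a P.T₂ - P.a) (left P.a P.T₂) := by
  have ha := P.a_pos
  have h1 := P.isWide_T₁.left_lt_right ha
  have h2 := (P.isWide_T₂.shift (-P.a)).left_lt_right ha
  have h12 := P.right_shift_T₂_lt_left_T₁
  have h12' := P.right_T₁_lt_left_T₂
  have hw := (P.isWide_of_mem_representatives hT).left_lt_right ha
  rw [P.isWide_T₂.left_shift] at h2
  rcases hT with ⟨t, h | h, rfl⟩ | rfl | rfl
  · have := P.between_of_tree_base h
    constructor <;> linarith
  · have := P.between_of_tree_nu h
    constructor <;> linarith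
  · constructor <;> linarith
  · rw [P.isWide_T₂.left_shift]
    constructor <;> linarith

/-- Two left endpoints in one half open period of length `a` cannot differ by a nonzero multiple of
`a`. -/
theorem eq_of_shift_mem {T : SL(2, ℝ)} {n : ℤ} (hT : T ∈ P.representatives)
    (h : shift (n * P.a) T ∈ P.representatives) : shift (n * P.a) T = T := by
  have ha := P.a_pos
  have h1 := P.left_mem_Ico hT
  have h2 := P.left_mem_Ico h
  rw [(P.isWide_of_mem_representatives hT).left_shift] at h2
  have hlt : (n : ℝ) < 1 := by
    by_contra! hn
    nlinarith [h1.1, h2.2]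
  have hgt : (-1 : ℝ) < n := by
    by_contra! hn
    nlinarith [h1.2, h2.1]
  have hlt' : n < 1 := by exact_mod_cast hlt
  have hgt' : -1 < n := by exact_mod_cast hgt
  obtain rfl : n = 0 := by omega
  simp [shift_zero]

theorem existsUnique_representative {T : SL(2, ℝ)} (hT : T ∈ P.appearing) :
    ∃! T', T' ∈ P.representatives ∧ ∃ n : ℤ, T' = shift (n * P.a) T := by
  have hex : ∃ n : ℤ, shift (n * P.a) T ∈ P.representatives := by
    obtain ⟨t, ht, rfl | rfl | rfl⟩ := hT
    · exact ⟨0, by simpa [shift_zero] using P.E_mem_representatives ht⟩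
    · rcases (P.F_G_mem_representatives ht).1 with h | h
      · exact ⟨0, by simpa [shift_zero] using h⟩
      · exact ⟨-1, by simpa [h] using P.shift_T₂_mem_representatives⟩
    · exact ⟨-1, by simpa using (P.F_G_mem_representatives ht).2⟩
  obtain ⟨n, hn⟩ := hex
  refine ⟨_, ⟨hn, n, rfl⟩, ?_⟩
  rintro _ ⟨hm, m, rfl⟩
  have h : shift (m * P.a) T = shift ((m - n : ℤ) * P.a) (shift (n * P.a) T) := by
    rw [shift_shift]
    congr 1
    push_cast
    ring
  rw [h] at hm ⊢
  exact P.eq_of_shift_mem hn hm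

theorem exists_appearing {T' : SL(2, ℝ)} (hT' : T' ∈ P.representatives) :
    ∃ T ∈ P.appearing, ∃ n : ℤ, T' = shift (n * P.a) T := by
  rcases hT' with ⟨t, ht, rfl⟩ | rfl | rfl
  · exact ⟨t.E, ⟨t, ht, .inl rfl⟩, 0, by simp [shift_zero]⟩
  · exact ⟨P.T₁, ⟨P.base, P.base_mem_nodes, .inr (.inl rfl)⟩, 0, by simp [shift_zero]⟩
  · exact ⟨P.T₂, ⟨P.base, P.base_mem_nodes, .inr (.inr rfl)⟩, -1, by simp⟩

theorem ne_T₂_of_mem_representatives {T : SL(2, ℝ)} (hT : T ∈ P.representatives) : T ≠ P.T₂ := by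
  rintro rfl
  exact (P.left_mem_Ico hT).2.false

theorem normalizedConfiguration_eq :
    P.normalizedConfiguration =
      ⋃ T ∈ P.representatives, (regionPlus T ∪ regionMinus (shift P.a T)) := by
  rw [normalizedConfiguration, vadd_image_regionPlus _ P.isWide_T₂]
  have sub {T : SL(2, ℝ)} (hT : T ∈ P.representatives) :
      regionPlus T ∪ regionMinus (shift P.a T) ⊆
        ⋃ T ∈ P.representatives, (regionPlus T ∪ regionMinus (shift P.a T)) :=
    Set.subset_biUnion_of_mem (u := fun T => regionPlus T ∪ regionMinus (shift P.a T)) hT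
  apply Set.Subset.antisymm
  · refine Set.union_subset (Set.union_subset ?_ ?_) ?_
    · refine Set.iUnion₂_subset fun t ht => ?_
      have h := sub (P.F_G_mem_representatives ht).2
      rw [shift_shift_neg] at h
      exact Set.subset_union_right.trans h
    · refine Set.iUnion₂_subset fun t ht => ?_
      exact Set.subset_union_left.trans
        (sub ((P.F_G_mem_representatives ht.1).1.resolve_right ht.2))
    · exact Set.subset_union_left.trans (sub P.shift_T₂_mem_representatives)
  · have minus (t : Triple) (ht : t ∈ P.nodes) {A : SL(2, ℝ)} (hA : t.G = A) :
        regionMinus A ⊆ ⋃ t ∈ P.nodes, regionMinus t.G :=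
      hA ▸ Set.subset_biUnion_of_mem (u := fun t : Triple => regionMinus t.G) ht
    have plus (t : Triple) (ht : t ∈ P.nodes) {A : SL(2, ℝ)} (hA : t.F = A)
        (hF : A ∈ P.representatives) :
        regionPlus A ⊆ ⋃ t ∈ {t ∈ P.nodes | t.F ≠ P.T₂}, regionPlus t.F := by
      subst hA
      exact Set.subset_biUnion_of_mem (u := fun t : Triple => regionPlus t.F)
        (show t ∈ {t ∈ P.nodes | t.F ≠ P.T₂} from ⟨ht, P.ne_T₂_of_mem_representatives hF⟩)
    refine Set.iUnion₂_subset fun T hT => Set.union_subset ?_ ?_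
    · rcases hT with ⟨t, ht, rfl⟩ | rfl | rfl
      · exact (plus t.lam (P.lam_mem_nodes ht) rfl (P.E_mem_representatives ht)).trans
          (Set.subset_union_right.trans Set.subset_union_left)
      · exact (plus P.base P.base_mem_nodes rfl P.T₁_mem_representatives).trans
          (Set.subset_union_right.trans Set.subset_union_left)
      · exact Set.subset_union_right
    · refine .trans ?_ (Set.subset_union_left.trans Set.subset_union_left)
      rcases hT with ⟨t, ht, rfl⟩ | rfl | rfl
      · exact minus (t.rho P.a) (P.rho_mem_nodes ht) rfl
      · exact minus (P.base.nu P.a) P.nu_base_mem_nodes rfl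
      · rw [shift_shift_neg]
        exact minus P.base P.base_mem_nodes rfl

end FrickeTriple

end Uplift

theorem proposition4 (P : Uplift.FrickeTriple) :
    -- the index set: one element for each appearing order-two element modulo `S^a`
    ((∀ T ∈ P.appearing, ∃! T', T' ∈ P.representatives ∧
        ∃ n : ℤ, T' = Uplift.shift (n * P.a) T) ∧
      (∀ T' ∈ P.representatives, ∃ T ∈ P.appearing,
        ∃ n : ℤ, T' = Uplift.shift (n * P.a) T)) ∧
    -- `U₊(T) ∪ U₋(S^a T S^{-a})` meets the line in an open interval
    (∀ T ∈ P.representatives, ∃ u v : ℝ, u < v ∧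
      Uplift.excision P.a T =
        {w : UpperHalfPlane | w.im = P.a / 2 ∧ w.re ∈ Set.Ioo u v}) ∧
    -- these intervals are pairwise disjoint
    P.representatives.PairwiseDisjoint (Uplift.excision P.a) ∧
    -- their union is the trace of the normalized uplift configuration
    P.normalizedConfiguration ∩ Uplift.line (P.a / 2) =
      ⋃ T ∈ P.representatives, Uplift.excision P.a T := by
  have ha := P.a_pos
  refine ⟨⟨fun T hT => P.existsUnique_representative hT, fun T' hT' => P.exists_appearing hT'⟩,
    fun T hT => ?_, fun T hT T' hT' hne => ?_, ?_⟩
  · have hw := P.isWide_of_mem_representatives hT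
    exact ⟨_, _, hw.left_lt_right ha, Uplift.excision_eq ha hw⟩
  · have hw := P.isWide_of_mem_representatives hT
    have hw' := P.isWide_of_mem_representatives hT'
    rcases (P.eq_or_separated hT hT').resolve_left hne with h | h
    · exact Uplift.disjoint_excision ha hw hw' h
    · exact (Uplift.disjoint_excision ha hw' hw h).symm
  · rw [P.normalizedConfiguration_eq, Set.iUnion₂_inter]
    rfl
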